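/- Let $\mathbb{R}^{0,2,1}$ denote $\mathbb{R}^3$ with coordinates $(x,y,z)$, the degenerate metric $(\cdot,\cdot)=dx^2+dy^2$ and the canonical flat connection $d$, and let $\xi=(0,0,1)$. Let $M$ be a connected two-dimensional smooth manifold and let $f:M\to\mathbb{R}^{0,2,1}$ be a $C^\infty$ immersion whose induced metric $g=f^*(\cdot,\cdot)$ is positive definite. Its second fundamental form $h$ is defined by the decomposition $d_XY=\nabla_XY+h(X,Y)\,\xi$ for tangent vector fields $X,Y$ of $M$, where $\nabla_XY$ is tangent to $M$. Suppose that $f$ is $d$-minimal, i.e. $\tfrac12\operatorname{tr}_g h=\tfrac12 g^{ij}h_{ij}=0$ on $M$, and complete, i.e. the Riemannian manifold $(M,g)$ is complete. Then there is a smooth harmonic function $\psi:\mathbb{R}^2\to\mathbb{R}$ such that \[ f(M)=\{(u,v,\psi(u,v)) \mid (u,v)\in\mathbb{R}^2\}. \] -/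

import Mathlib

open scoped Manifold ContDiff Topology ENNReal

namespace Isotropic

noncomputable section

/-- The Euclidean plane, which is also the model space of two-dimensional manifolds. -/
abbrev Plane : Type := EuclideanSpace ℝ (Fin 2)

/-- The underlying smooth manifold `ℝ³` of `ℝ^{0,2,1}`, with coordinates `x = p 0`, `y = p 1`,
`z = p 2`. Its Euclidean norm is used only for calculus. -/
abbrev Space : Type := EuclideanSpace ℝ (Fin 3)

/-- The degenerate metric `dx² + dy²` of `ℝ^{0,2,1}`. -/
def form (v w : Space) : ℝ := v 0 * w 0 + v 1 * w 1

/-- The constant transversal vector field `ξ = (0, 0, 1)`. -/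
def xi : Space := !₂[0, 0, 1]

section Surface

variable {M : Type*} [TopologicalSpace M] [ChartedSpace Plane M]

/-- The differential `df_x : T_x M → ℝ³`. -/
def df (f : M → Space) (x : M) : TangentSpace (𝓡 2) x →L[ℝ] Space :=
  mfderiv (𝓡 2) (𝓡 3) f x

/-- The induced metric `g = f^* (dx² + dy²)`. -/
def inducedMetric (f : M → Space) (x : M) (v w : TangentSpace (𝓡 2) x) : ℝ :=
  form (df f x v) (df f x w)

/-- A non-degenerate immersion (or non-degenerate surface): a `C^∞` immersion whose induced metric
is positive definite. -/
structure IsNondegenerate (f : M → Space) : Prop where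
  contMDiff : ContMDiff (𝓡 2) (𝓡 3) ∞ f
  injective_df : ∀ x, Function.Injective (df f x)
  pos_def : ∀ (x : M) (v : TangentSpace (𝓡 2) x), v ≠ 0 → 0 < inducedMetric f x v v

/-- The coefficient `c` of `ξ` in the decomposition `w = df_x t + c ξ` of a vector along
`T_{f(x)} ℝ³ = df_x (T_x M) ⊕ ℝ ξ`; it exists and is unique if `f` is non-degenerate. -/
def normalCoeff (f : M → Space) (x : M) (w : Space) : ℝ :=
  Classical.epsilon fun c : ℝ => ∃ t : TangentSpace (𝓡 2) x, w = df f x t + c • xi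

/-- `d_X Y` at `x`, where `d` is the canonical flat connection of `ℝ³` and `Y` is regarded as the
`ℝ³`-valued function `y ↦ df_y (Y y)`. -/
def ambientDeriv (f : M → Space) (X Y : ∀ x : M, TangentSpace (𝓡 2) x) (x : M) : Space :=
  mfderiv (𝓡 2) 𝓘(ℝ, Space) (fun y => df f y (Y y)) x (X x)

/-- The second fundamental form `h(X, Y)` at `x`, defined by `d_X Y = ∇_X Y + h(X, Y) ξ`. -/
def secondFundForm (f : M → Space) (X Y : ∀ x : M, TangentSpace (𝓡 2) x) (x : M) : ℝ :=
  normalCoeff f x (ambientDeriv f X Y x)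

/-- The coordinate vector field `∂_i` of a chart `φ` (meaningful on `φ.source`). -/
def coordField (φ : OpenPartialHomeomorph M Plane) (i : Fin 2) (x : M) : TangentSpace (𝓡 2) x :=
  (mfderiv (𝓡 2) 𝓘(ℝ, Plane) φ x).inverse (EuclideanSpace.single i (1 : ℝ))

/-- The matrix `g_{ij} = g(∂_i, ∂_j)` at `x` in the chart `φ`. -/
def metricMatrix (f : M → Space) (φ : OpenPartialHomeomorph M Plane) (x : M) :
    Matrix (Fin 2) (Fin 2) ℝ :=
  Matrix.of fun i j => inducedMetric f x (coordField φ i x) (coordField φ j x)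

/-- The matrix `h_{ij} = h(∂_i, ∂_j)` at `x` in the chart `φ`. -/
def secondFundMatrix (f : M → Space) (φ : OpenPartialHomeomorph M Plane) (x : M) :
    Matrix (Fin 2) (Fin 2) ℝ :=
  Matrix.of fun i j => secondFundForm f (coordField φ i) (coordField φ j) x

/-- The mean curvature `(1/2) tr_g h = (1/2) g^{ij} h_{ij}` at `x`, computed in the chart `φ`. -/
def meanCurvature (f : M → Space) (φ : OpenPartialHomeomorph M Plane) (x : M) : ℝ :=
  1 / 2 * ∑ i, ∑ j, (metricMatrix f φ x)⁻¹ i j * secondFundMatrix f φ x i j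

/-- A `d`-minimal surface: a non-degenerate surface whose mean curvature vanishes (in every chart
of the smooth structure; the value does not depend on the chart). -/
structure IsDMinimal (f : M → Space) : Prop where
  nondegenerate : IsNondegenerate f
  meanCurvature_eq_zero : ∀ φ ∈ IsManifold.maximalAtlas (𝓡 2) ∞ M, ∀ x ∈ φ.source,
    meanCurvature f φ x = 0

/-- The length `√g(v, v)` of tangent vectors with respect to the induced metric. -/
abbrev inducedENorm (f : M → Space) (x : M) : ENorm (TangentSpace (𝓡 2) x) :=
  ⟨fun v => ENNReal.ofReal (√(inducedMetric f x v v))⟩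

/-- The Riemannian distance of the induced metric: the infimum of the lengths of `C^1` paths. -/
def inducedEDist (f : M → Space) (x y : M) : ℝ≥0∞ :=
  letI := inducedENorm f
  Manifold.riemannianEDist (𝓡 2) x y

/-- The surface is complete: every sequence of `M` which is Cauchy for the Riemannian distance of
the induced metric converges in `M`. -/
def IsCompleteSurface (f : M → Space) : Prop :=
  ∀ u : ℕ → M,
    (∀ ε : ℝ≥0∞, 0 < ε → ∃ N : ℕ, ∀ m ≥ N, ∀ n ≥ N, inducedEDist f (u m) (u n) < ε) →
    ∃ x : M, Filter.Tendsto u Filter.atTop (𝓝 x)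

end Surface

end

end Isotropic

/-! The metric `dx² + dy²` is pulled back from the Euclidean plane by `proj`, so `proj ∘ f` is a
local isometry from `(M, g)` to the flat plane. As for any local isometry from a complete manifold,
segments lift: a lift has the same speed as its segment, so its endpoints are Cauchy and converge
(`IsNondegenerate.exists_isLiftOn`). Lifting the segments from one point gives a section, which
connectedness makes a two-sided inverse; `proj ∘ f` is thus a global chart
(`IsNondegenerate.exists_global_chart`) and `f(M)` is the graph of a smooth `ψ`. In this chart `g`
is the identity and `h` is the Hessian of `ψ`, so `d`-minimality reads `Δψ = 0`
(`meanCurvature_graph`). -/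

namespace Isotropic

open Set Filter

/-! ### Inverse function theorem on a surface -/

section LocalDiffeo

theorem exists_continuousLinearEquiv_coe_eq {A : Plane →L[ℝ] Plane} (hA : Function.Injective A) :
    ∃ B : Plane ≃L[ℝ] Plane, (B : Plane →L[ℝ] Plane) = A :=
  ⟨(LinearEquiv.ofInjectiveEndo (A : Plane →ₗ[ℝ] Plane) hA).toContinuousLinearEquiv, rfl⟩

theorem apply_inverse_of_injective {A : Plane →L[ℝ] Plane} (hA : Function.Injective A) (v : Plane) :
    A (A.inverse v) = v := by
  obtain ⟨B, rfl⟩ := exists_continuousLinearEquiv_coe_eq hA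
  simp

variable {M : Type*} [TopologicalSpace M] [ChartedSpace Plane M] [IsManifold (𝓡 2) ∞ M]

/-- The inverse function theorem for maps of a surface into the plane: near every point, a smooth
map with injective differentials is a chart of the smooth structure. -/
theorem exists_chart_eqOn {F : M → Plane} (hF : ContMDiff (𝓡 2) (𝓡 2) ∞ F)
    (hinj : ∀ x, Function.Injective (mfderiv (𝓡 2) (𝓡 2) F x)) (x : M) :
    ∃ e ∈ IsManifold.maximalAtlas (𝓡 2) ∞ M, x ∈ e.source ∧ EqOn e F e.source := by
  set φ := chartAt Plane x with hφ
  have hφm : φ ∈ IsManifold.maximalAtlas (𝓡 2) ∞ M := IsManifold.chart_mem_maximalAtlas x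
  have hxφ : x ∈ φ.source := mem_chart_source Plane x
  have hφsymm : ContMDiffOn (𝓡 2) (𝓡 2) ∞ φ.symm φ.target :=
    contMDiffOn_symm_of_mem_maximalAtlas hφm
  set G : Plane → Plane := F ∘ φ.symm with hG
  have hGs : ∀ y ∈ φ.target, ContDiffAt ℝ ∞ G y := fun y hy => by
    have h1 : ContMDiffAt (𝓡 2) (𝓡 2) ∞ φ.symm y := hφsymm.contMDiffAt (φ.open_target.mem_nhds hy)
    exact (hF.contMDiffAt.comp y h1).contDiffAt
  have hmd : φ.MDifferentiable (𝓡 2) (𝓡 2) :=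
    haveI : IsManifold (𝓡 2) 1 M := IsManifold.of_le (n := ∞) (by simp)
    mdifferentiable_of_mem_atlas (chart_mem_atlas Plane x)
  have hGd : ∀ y ∈ φ.target, ∃ A : Plane ≃L[ℝ] Plane, HasFDerivAt G (A : Plane →L[ℝ] Plane) y := by
    intro y hy
    have hd := (hGs y hy).differentiableAt (by simp)
    have hcomp : mfderiv (𝓡 2) (𝓡 2) G y =
        (mfderiv (𝓡 2) (𝓡 2) F (φ.symm y)).comp (mfderiv (𝓡 2) (𝓡 2) φ.symm y) :=
      mfderiv_comp y (hF.mdifferentiable (by simp) _) (hmd.mdifferentiableAt_symm hy)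
    have hi : Function.Injective (fderiv ℝ G y) := by
      rw [← mfderiv_eq_fderiv, hcomp]
      exact (hinj _).comp (hmd.symm.mfderiv_injective hy)
    obtain ⟨A, hA⟩ := exists_continuousLinearEquiv_coe_eq hi
    exact ⟨A, hA ▸ hd.hasFDerivAt⟩
  obtain ⟨A, hA⟩ := hGd _ (φ.map_source hxφ)
  let E := (hGs _ (φ.map_source hxφ)).toOpenPartialHomeomorph G hA (by simp)
  have hEx : φ x ∈ E.source := ContDiffAt.mem_toOpenPartialHomeomorph_source _ hA (by simp)
  have hEG : ⇑E = G := rfl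
  have heq : EqOn (φ.trans E) F (φ.trans E).source := by
    intro y hy
    rw [OpenPartialHomeomorph.trans_source] at hy
    simp [hEG, hG, φ.left_inv hy.1]
  refine ⟨φ.trans E, ?_, by simp [hxφ, hEx], heq⟩
  apply OpenPartialHomeomorph.mem_maximalAtlas_of_contMDiffOn
  · exact hF.contMDiffOn.congr heq
  · intro y hy
    rw [OpenPartialHomeomorph.trans_target] at hy
    obtain ⟨B, hB⟩ := hGd _ hy.2
    have h1 : ContDiffAt ℝ ∞ E.symm y := E.contDiffAt_symm hy.1 hB (hGs _ hy.2)
    have h2 : ContMDiffAt (𝓡 2) (𝓡 2) ∞ φ.symm (E.symm y) :=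
      hφsymm.contMDiffAt (φ.open_target.mem_nhds hy.2)
    exact (h2.comp y h1.contMDiffAt).contMDiffWithinAt

end LocalDiffeo

/-! ### The projection to the plane as a local diffeomorphism -/

section Projection

/-- The projection of `ℝ^{0,2,1}` onto the `xy`-plane. -/
noncomputable def proj : Space →L[ℝ] Plane :=
  LinearMap.toContinuousLinearMap
    { toFun := fun p => !₂[p 0, p 1]
      map_add' := fun p q => by ext i; fin_cases i <;> simp
      map_smul' := fun c p => by ext i; fin_cases i <;> simp }

@[simp] theorem proj_apply (p : Space) : proj p = !₂[p 0, p 1] := rfl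

theorem norm_proj_sq (p : Space) : ‖proj p‖ ^ 2 = form p p := by
  rw [EuclideanSpace.norm_sq_eq]
  simp [form, sq]

variable {M : Type*} [TopologicalSpace M] [ChartedSpace Plane M] {f : M → Space}

theorem IsNondegenerate.contMDiff_proj (hf : IsNondegenerate f) :
    ContMDiff (𝓡 2) (𝓡 2) ∞ (proj ∘ f) :=
  proj.contDiff.contMDiff.comp hf.contMDiff

theorem IsNondegenerate.mfderiv_proj (hf : IsNondegenerate f) (x : M) :
    mfderiv (𝓡 2) (𝓡 2) (proj ∘ f) x = (proj ∘L df f x : TangentSpace (𝓡 2) x →L[ℝ] Plane) := by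
  have h := mfderiv_comp (I := 𝓡 2) (I' := 𝓡 3) (I'' := 𝓡 2) x (g := proj) (f := f)
    proj.differentiableAt.mdifferentiableAt (hf.contMDiff.mdifferentiable (by simp) x)
  rw [h, mfderiv_eq_fderiv, proj.fderiv]
  rfl

theorem inducedMetric_self (f : M → Space) (x : M) (v : TangentSpace (𝓡 2) x) :
    inducedMetric f x v v = ‖proj (df f x v)‖ ^ 2 :=
  (norm_proj_sq _).symm

theorem inducedENorm_eq (f : M → Space) (x : M) (v : TangentSpace (𝓡 2) x) :
    (inducedENorm f x).enorm v = ‖proj (df f x v)‖ₑ := by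
  change ENNReal.ofReal (√(inducedMetric f x v v)) = _
  rw [inducedMetric_self, Real.sqrt_sq (norm_nonneg _), ofReal_norm]

/-- Since `g(v, v) = ‖d(proj ∘ f) v‖²`, positive definiteness rules out a kernel. -/
theorem IsNondegenerate.injective_mfderiv_proj (hf : IsNondegenerate f) (x : M) :
    Function.Injective (mfderiv (𝓡 2) (𝓡 2) (proj ∘ f) x) := by
  rw [hf.mfderiv_proj]
  refine (injective_iff_map_eq_zero (proj ∘L df f x : TangentSpace (𝓡 2) x →L[ℝ] Plane)).2
    fun v hv => ?_
  by_contra hne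
  have h := hf.pos_def x v hne
  rw [inducedMetric_self, show proj (df f x v) = 0 from hv] at h
  simp at h

theorem IsNondegenerate.exists_chart_eqOn_proj [IsManifold (𝓡 2) ∞ M] (hf : IsNondegenerate f)
    (x : M) : ∃ e ∈ IsManifold.maximalAtlas (𝓡 2) ∞ M, x ∈ e.source ∧
      EqOn e (proj ∘ f) e.source :=
  exists_chart_eqOn hf.contMDiff_proj hf.injective_mfderiv_proj x

theorem IsNondegenerate.isLocalHomeomorph_proj [IsManifold (𝓡 2) ∞ M] (hf : IsNondegenerate f) :
    IsLocalHomeomorph (proj ∘ f) :=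
  IsLocalHomeomorph.mk _ fun x => by
    obtain ⟨e, -, hx, he⟩ := hf.exists_chart_eqOn_proj x
    exact ⟨e, hx, he.symm⟩

end Projection

/-! ### Lengths of lifted curves -/

section Length

variable {M : Type*} [TopologicalSpace M] [ChartedSpace Plane M] {f : M → Space}

theorem enormSMulClass_inducedENorm (f : M → Space) (x : M) :
    letI := inducedENorm f x
    ENormSMulClass ℝ (TangentSpace (𝓡 2) x) := by
  let _ := inducedENorm f x
  refine ⟨fun c v => ?_⟩
  rw [inducedENorm_eq, inducedENorm_eq, map_smul, map_smul, enorm_smul]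

theorem inducedEDist_comm (f : M → Space) (x y : M) : inducedEDist f x y = inducedEDist f y x := by
  let _ := inducedENorm f
  have := enormSMulClass_inducedENorm f
  exact Manifold.riemannianEDist_comm

variable [IsManifold (𝓡 2) ∞ M]

/-- A continuous lift of a smooth plane curve is smooth. -/
theorem IsNondegenerate.contMDiffOn_lift (hf : IsNondegenerate f) {γ : ℝ → Plane}
    (hγ : ContDiff ℝ ∞ γ) {Γ : ℝ → M} {s : Set ℝ} (hΓ : ContinuousOn Γ s)
    (hlift : EqOn (proj ∘ f ∘ Γ) γ s) : ContMDiffOn 𝓘(ℝ, ℝ) (𝓡 2) ∞ Γ s := by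
  intro t ht
  obtain ⟨e, hem, hx, he⟩ := hf.exists_chart_eqOn_proj (Γ t)
  -- Where the projection is a chart, a lift is the inverse chart applied to the smooth curve `γ`.
  have key : ∀ r ∈ s, Γ r ∈ e.source → Γ r = (e.symm ∘ γ) r := fun r hr hre => by
    rw [Function.comp_apply, ← hlift hr]
    change _ = e.symm ((proj ∘ f) (Γ r))
    rw [← he hre, e.left_inv hre]
  have hγt : γ t ∈ e.target := by
    rw [← hlift ht]
    change (proj ∘ f) (Γ t) ∈ _
    rw [← he hx]
    exact e.map_source hx
  have h1 : ContMDiffAt 𝓘(ℝ, ℝ) (𝓡 2) ∞ (e.symm ∘ γ) t :=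
    ((contMDiffOn_symm_of_mem_maximalAtlas hem).contMDiffAt
      (e.open_target.mem_nhds hγt)).comp t hγ.contMDiff.contMDiffAt
  refine h1.contMDiffWithinAt.congr_of_eventuallyEq ?_ (key t ht hx)
  filter_upwards [self_mem_nhdsWithin, (hΓ t ht) (e.open_source.mem_nhds hx)] with r hr hre
  exact key r hr hre

/-- The projection to the plane preserves the lengths of curves. -/
theorem IsNondegenerate.inducedEDist_lift_le (hf : IsNondegenerate f) {γ : ℝ → Plane} {w : Plane}
    (hγ : ContDiff ℝ ∞ γ) (hw : ∀ t, HasDerivAt γ w t) {Γ : ℝ → M} {a b : ℝ}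
    (hΓ : ContinuousOn Γ (Icc a b)) (hlift : EqOn (proj ∘ f ∘ Γ) γ (Icc a b)) (hab : a ≤ b) :
    inducedEDist f (Γ a) (Γ b) ≤ ‖w‖ₑ * ENNReal.ofReal (b - a) := by
  let _ := inducedENorm f
  have := enormSMulClass_inducedENorm f
  have hsm := hf.contMDiffOn_lift hγ hΓ hlift
  refine (Manifold.riemannianEDist_le_pathELength (I := 𝓡 2) (hsm.of_le (by simp)) rfl rfl
    hab).trans ?_
  rw [Manifold.pathELength_eq_lintegral_mfderiv_Ioo]
  have : ∀ t ∈ Ioo a b, (inducedENorm f (Γ t)).enorm (mfderiv 𝓘(ℝ, ℝ) (𝓡 2) Γ t 1) = ‖w‖ₑ := by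
    intro t ht
    have hΓt : MDifferentiableAt 𝓘(ℝ, ℝ) (𝓡 2) Γ t :=
      (hsm.contMDiffAt (Icc_mem_nhds ht.1 ht.2)).mdifferentiableAt (by simp)
    have hc := mfderiv_comp (I := 𝓘(ℝ, ℝ)) (I' := 𝓡 2) (I'' := 𝓡 2) t (g := proj ∘ f) (f := Γ)
      (hf.contMDiff_proj.mdifferentiable (by simp) _) hΓt
    have hev : (proj ∘ f) ∘ Γ =ᶠ[𝓝 t] γ := by
      filter_upwards [Icc_mem_nhds ht.1 ht.2] with r hr using hlift hr
    rw [hf.mfderiv_proj, hev.mfderiv_eq, mfderiv_eq_fderiv] at hc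
    rw [inducedENorm_eq]
    have h1 : fderiv ℝ γ t 1 = w := by rw [fderiv_apply_one_eq_deriv]; exact (hw t).deriv
    rw [← h1, hc]
    rfl
  rw [MeasureTheory.setLIntegral_congr_fun measurableSet_Ioo this]
  simp

end Length

/-! ### Uniqueness and extension of lifts -/

section Lifting

/-- `Γ` is a lift through `F` on `[0, T]` of the curve `γ`, starting at `p`. -/
structure IsLiftOn {M X : Type*} [TopologicalSpace M] (F : M → X) (γ : ℝ → X) (p : M) (T : ℝ)
    (Γ : ℝ → M) : Prop where
  continuousOn : ContinuousOn Γ (Icc 0 T)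
  zero : Γ 0 = p
  lifts : EqOn (F ∘ Γ) γ (Icc 0 T)

variable {M X : Type*} [TopologicalSpace M] {F : M → X} {γ : ℝ → X} {p : M}
  {T T' : ℝ} {Γ Γ' : ℝ → M}

theorem IsLiftOn.mono (h : IsLiftOn F γ p T' Γ) (hT : T ≤ T') : IsLiftOn F γ p T Γ :=
  ⟨h.continuousOn.mono (Icc_subset_Icc_right hT), h.zero, h.lifts.mono (Icc_subset_Icc_right hT)⟩

variable [TopologicalSpace X]

theorem IsLiftOn.eqOn [T2Space M] (hF : IsLocalHomeomorph F) (h : IsLiftOn F γ p T Γ)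
    (h' : IsLiftOn F γ p T Γ') (hT : 0 ≤ T) : EqOn Γ Γ' (Icc 0 T) :=
  (T2Space.isSeparatedMap F).eqOn_of_comp_eqOn hF.isLocallyInjective isPreconnected_Icc
    h.continuousOn h'.continuousOn (h.lifts.trans h'.lifts.symm) (left_mem_Icc.2 hT)
    (h.zero.trans h'.zero.symm)

/-- A lift extends past `T` as long as the curve stays in a region evenly covered around its
endpoint. -/
theorem IsLiftOn.exists_extend (h : IsLiftOn F γ p T Γ) (hγ : Continuous γ) (hT : 0 ≤ T)
    (hTT' : T ≤ T') (e : OpenPartialHomeomorph M X) (he : EqOn e F e.source)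
    (hΓT : Γ T ∈ e.source) (hmem : ∀ t ∈ Icc T T', γ t ∈ e.target) :
    ∃ Γ', IsLiftOn F γ p T' Γ' := by
  classical
  have hagree : e.symm (γ T) = Γ T := by
    rw [← h.lifts (right_mem_Icc.2 hT), Function.comp_apply, ← he hΓT, e.left_inv hΓT]
  have hcont : ContinuousOn (e.symm ∘ γ) (Icc T T') :=
    e.continuousOn_symm.comp hγ.continuousOn hmem
  refine ⟨fun t => if t ≤ T then Γ t else (e.symm ∘ γ) t, ?_, by simp [hT, h.zero], ?_⟩
  · rw [← Icc_union_Icc_eq_Icc hT hTT']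
    refine ContinuousOn.union_of_isClosed ?_ ?_ isClosed_Icc isClosed_Icc
    · exact h.continuousOn.congr fun t ht => by simp [ht.2]
    · refine hcont.congr fun t ht => ?_
      rcases ht.1.eq_or_lt with rfl | hlt
      · simp [hagree]
      · simp [hlt.not_ge]
  · intro t ht
    by_cases htT : t ≤ T
    · simpa [htT] using h.lifts ⟨ht.1, htT⟩
    · have hm := hmem t ⟨(not_le.1 htT).le, ht.2⟩
      simp only [Function.comp_apply, htT, if_false]
      rw [← he (e.map_target hm), e.right_inv hm]

end Lifting

/-! ### Completeness makes the projection a global chart -/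

section Completeness

variable {M : Type*} [TopologicalSpace M] [T2Space M] [ChartedSpace Plane M]
  [IsManifold (𝓡 2) ∞ M] {f : M → Space}

/-- On a complete surface every line segment of the plane lifts. -/
theorem IsNondegenerate.exists_isLiftOn (hf : IsNondegenerate f) (hc : IsCompleteSurface f)
    {γ : ℝ → Plane} {w : Plane} (hγ : ContDiff ℝ ∞ γ) (hw : ∀ t, HasDerivAt γ w t) (p : M)
    (hp : proj (f p) = γ 0) : ∃ Γ, IsLiftOn (proj ∘ f) γ p 1 Γ := by
  set s : Set ℝ := {T | ∃ Γ, IsLiftOn (proj ∘ f) γ p T Γ} with hs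
  have hloc := hf.isLocalHomeomorph_proj
  -- Continuous induction on the times up to which a lift exists.
  suffices h : Icc (0 : ℝ) 1 ⊆ s from h (right_mem_Icc.2 zero_le_one)
  refine IsClosed.Icc_subset_of_forall_exists_gt ?_ ?_ ?_
  · refine isClosed_of_closure_subset fun T hT => ?_
    have hTI : T ∈ Icc (0 : ℝ) 1 :=
      isClosed_Icc.closure_subset_iff.2 inter_subset_right hT
    refine ⟨?_, hTI⟩
    by_contra hTs
    obtain ⟨t, hts, htT⟩ := mem_closure_iff_seq_limit.1 hT
    have hlt : ∀ n, t n < T := fun n => by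
      by_contra hge
      obtain ⟨Γ, hΓ⟩ := (hts n).1
      exact hTs ⟨Γ, hΓ.mono (not_lt.1 hge)⟩
    choose Γ hΓ using fun n => (hts n).1
    have hle : ∀ m n, t m ≤ t n →
        inducedEDist f (Γ m (t m)) (Γ n (t n)) ≤ ‖w‖ₑ * ENNReal.ofReal (t n - t m) := by
      intro m n hmn
      have h0 := (hts m).2.1
      -- By uniqueness of lifts, both endpoints lie on the single curve `Γ n`.
      rw [(hΓ m).eqOn hloc ((hΓ n).mono hmn) h0 (right_mem_Icc.2 h0)]
      exact hf.inducedEDist_lift_le hγ hw ((hΓ n).continuousOn.mono (Icc_subset_Icc_left h0))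
        ((hΓ n).lifts.mono (Icc_subset_Icc_left h0)) hmn
    have hle' : ∀ m n, inducedEDist f (Γ m (t m)) (Γ n (t n)) ≤
        ‖w‖ₑ * ENNReal.ofReal |t n - t m| := by
      intro m n
      rcases le_total (t m) (t n) with h | h
      · rw [abs_of_nonneg (sub_nonneg.2 h)]
        exact hle m n h
      · rw [inducedEDist_comm, abs_sub_comm, abs_of_nonneg (sub_nonneg.2 h)]
        exact hle n m h
    -- Completeness enters here: the endpoints are Cauchy because the times `t n` are.
    obtain ⟨x, hx⟩ := hc (fun n => Γ n (t n)) fun ε hε => by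
      have hcau := htT.cauchySeq
      have hlim : Tendsto (fun r : ℝ => ‖w‖ₑ * ENNReal.ofReal r) (𝓝 0) (𝓝 0) := by
        have h1 := ENNReal.Tendsto.const_mul (a := ‖w‖ₑ)
          (ENNReal.continuous_ofReal.tendsto 0) (Or.inr enorm_ne_top)
        simpa using h1
      obtain ⟨δ, hδ, hδε⟩ := Metric.eventually_nhds_iff.1 (hlim.eventually (gt_mem_nhds hε))
      obtain ⟨N, hN⟩ := Metric.cauchySeq_iff.1 hcau δ hδ
      refine ⟨N, fun m hm n hn => (hle' m n).trans_lt (hδε ?_)⟩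
      rw [dist_zero_right, norm_abs_eq_norm]
      exact hN n hn m hm
    obtain ⟨e, -, hxe, he⟩ := hf.exists_chart_eqOn_proj x
    have hlift : ∀ n, (proj ∘ f) (Γ n (t n)) = γ (t n) := fun n =>
      (hΓ n).lifts (right_mem_Icc.2 (hts n).2.1)
    have hFx : (proj ∘ f) x = γ T := by
      refine tendsto_nhds_unique ((hloc.continuous.tendsto x).comp hx) ?_
      exact ((hγ.continuous.tendsto T).comp htT).congr fun n => (hlift n).symm
    have hTt : γ T ∈ e.target := by
      rw [← hFx, ← he hxe]
      exact e.map_source hxe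
    obtain ⟨δ, hδ, hball⟩ := Metric.mem_nhds_iff.1
      (hγ.continuous.continuousAt.preimage_mem_nhds (e.open_target.mem_nhds hTt))
    -- For this `n`, the endpoint lies in the chart at `x` and `γ` maps `[t n, T]` into its target,
    -- so the lift extends to `T`.
    obtain ⟨n, hn1, hn2⟩ := ((hx.eventually (e.open_source.mem_nhds hxe)).and
      (htT.eventually (Metric.ball_mem_nhds T hδ))).exists
    refine hTs ((hΓ n).exists_extend hγ.continuous (hts n).2.1 (hlt n).le e he hn1
      fun r hr => hball ?_)
    rw [Real.dist_eq, abs_lt] at hn2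
    rw [Metric.mem_ball, Real.dist_eq, abs_lt]
    constructor <;> linarith [hr.1, hr.2]
  · refine ⟨fun _ => p, continuousOn_const, rfl, fun t ht => ?_⟩
    rw [le_antisymm ht.2 ht.1]
    exact hp
  · rintro T ⟨⟨Γ, hΓ⟩, hT⟩ y hy
    obtain ⟨e, -, hxe, he⟩ := hf.exists_chart_eqOn_proj (Γ T)
    have hTt : γ T ∈ e.target := by
      rw [← hΓ.lifts (right_mem_Icc.2 hT.1), Function.comp_apply, ← he hxe]
      exact e.map_source hxe
    obtain ⟨δ, hδ, hball⟩ := Metric.mem_nhds_iff.1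
      (hγ.continuous.continuousAt.preimage_mem_nhds (e.open_target.mem_nhds hTt))
    -- Halving `δ` keeps the closed interval inside the open ball.
    have hTT' : T < min y (T + δ / 2) := lt_min hy (by linarith)
    refine ⟨min y (T + δ / 2), hΓ.exists_extend hγ.continuous hT.1 hTT'.le e he hxe
      fun r hr => hball ?_, hTT', min_le_left _ _⟩
    have := hr.2.trans (min_le_right _ _)
    rw [Metric.mem_ball, Real.dist_eq, abs_lt]
    constructor <;> linarith [hr.1]

/-- The projection of a complete surface to the plane has a continuous section through every
point. -/
theorem IsNondegenerate.exists_section (hf : IsNondegenerate f) (hc : IsCompleteSurface f)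
    (p : M) : ∃ s : Plane → M, Continuous s ∧ (∀ q, proj (f (s q)) = q) ∧ s (proj (f p)) = p := by
  set o := proj (f p) with ho
  have hγ : ∀ q, ContDiff ℝ ∞ (fun t : ℝ => o + t • (q - o)) := fun q => by fun_prop
  have hw : ∀ q (t : ℝ), HasDerivAt (fun t : ℝ => o + t • (q - o)) (q - o) t := fun q t => by
    simpa using ((hasDerivAt_id t).smul_const (q - o)).const_add o
  choose Γ hΓ using fun q => hf.exists_isLiftOn hc (hγ q) (hw q) p (by simp [ho])
  -- The lifts were chosen separately for each `q`; joint continuity comes from the local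
  -- homeomorphism, and the section is the value at time `1`.
  have hcont : Continuous fun z : unitInterval × Plane => Γ z.2 z.1 := by
    refine hf.isLocalHomeomorph_proj.continuous_lift (T2Space.isSeparatedMap _)
      ⟨fun z : unitInterval × Plane => o + (z.1 : ℝ) • (z.2 - o), by fun_prop⟩ ?_ ?_ ?_
    · ext1 z
      exact (hΓ z.2).lifts z.1.2
    · exact continuous_const.congr fun q => (hΓ q).zero.symm
    · exact fun q => (hΓ q).continuousOn.comp_continuous continuous_subtype_val fun t => t.2
  refine ⟨fun q => Γ q 1, ?_, fun q => ?_, ?_⟩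
  · exact hcont.comp (Continuous.prodMk_right (1 : unitInterval))
  · simpa using (hΓ q).lifts (right_mem_Icc.2 zero_le_one)
  · have hconst : IsLiftOn (proj ∘ f) (fun t : ℝ => o + t • (o - o)) p 1 fun _ => p :=
      ⟨continuousOn_const, rfl, fun t _ => by simp [ho]⟩
    exact (hΓ o).eqOn hf.isLocalHomeomorph_proj hconst zero_le_one (right_mem_Icc.2 zero_le_one)

/-- A complete connected surface projects homeomorphically onto the plane, and the projection is a
global chart. -/
theorem IsNondegenerate.exists_global_chart [ConnectedSpace M] (hf : IsNondegenerate f)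
    (hc : IsCompleteSurface f) :
    ∃ H : M ≃ₜ Plane, ⇑H = proj ∘ f ∧
      H.toOpenPartialHomeomorph ∈ IsManifold.maximalAtlas (𝓡 2) ∞ M := by
  have hloc := hf.isLocalHomeomorph_proj
  obtain ⟨p⟩ : Nonempty M := inferInstance
  obtain ⟨s, hs, hsec, hp⟩ := hf.exists_section hc p
  -- Both sides lift `proj ∘ f` through itself and agree at `p`; `M` is connected.
  have hleft : s ∘ (proj ∘ f) = id :=
    (T2Space.isSeparatedMap (proj ∘ f)).eq_of_comp_eq hloc.isLocallyInjective
      (hs.comp hloc.continuous) continuous_id (funext fun x => hsec _) p hp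
  let H : M ≃ₜ Plane :=
    { toFun := proj ∘ f
      invFun := s
      left_inv := congrFun hleft
      right_inv := hsec
      continuous_toFun := hloc.continuous
      continuous_invFun := hs }
  refine ⟨H, rfl, OpenPartialHomeomorph.mem_maximalAtlas_of_contMDiffOn _ ?_ ?_⟩
  · exact hf.contMDiff_proj.contMDiffOn
  · intro q _
    obtain ⟨e, hem, hx, he⟩ := hf.exists_chart_eqOn_proj (s q)
    have hqe : q ∈ e.target := by
      have := e.map_source hx
      rwa [he hx, Function.comp_apply, hsec] at this
    have h1 : ContMDiffAt (𝓡 2) (𝓡 2) ∞ e.symm q :=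
      (contMDiffOn_symm_of_mem_maximalAtlas hem).contMDiffAt (e.open_target.mem_nhds hqe)
    refine (h1.congr_of_eventuallyEq ?_).contMDiffWithinAt
    filter_upwards [hs.continuousAt.preimage_mem_nhds (e.open_source.mem_nhds hx)] with r hr
    change s r = e.symm r
    rw [← e.left_inv hr, he hr, Function.comp_apply, hsec]

end Completeness

/-! ### Curvature of a graph -/

section Curvature

variable {M : Type*} [TopologicalSpace M] [ChartedSpace Plane M] {f : M → Space}

/-- Projecting any decomposition kills `xi` and forces the tangential part to vanish; the third
coordinate then determines the coefficient. -/
theorem normalCoeff_smul_xi (hf : IsNondegenerate f) (x : M) (c : ℝ) :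
    normalCoeff f x (c • xi) = c := by
  have hex : ∃ d : ℝ, ∃ t : TangentSpace (𝓡 2) x, c • xi = df f x t + d • xi :=
    ⟨c, 0, by simp⟩
  obtain ⟨t, ht⟩ := Classical.epsilon_spec hex
  change c • xi = df f x t + normalCoeff f x (c • xi) • xi at ht
  have hxi : proj xi = 0 := by ext i; fin_cases i <;> simp [xi]
  have ht0 : t = 0 := by
    apply hf.injective_mfderiv_proj x
    have h := congrArg proj ht
    simp only [map_add, map_smul, hxi, smul_zero, add_zero] at h
    rw [hf.mfderiv_proj]
    exact h.symm.trans (map_zero (proj ∘L df f x : TangentSpace (𝓡 2) x →L[ℝ] Plane)).symm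
  have h2 := congrArg (fun v : Space => v 2) ht
  simpa [ht0, xi] using h2.symm

/-- In the chart given by the projection to the plane, the mean curvature of a graph is half the
Laplacian of its height. -/
theorem meanCurvature_graph (hf : IsNondegenerate f) (H : M ≃ₜ Plane) (hH : ⇑H = proj ∘ f)
    {P : Plane → Space} (hP : ContDiff ℝ ∞ P) (hfP : f = P ∘ H) (x : M) :
    meanCurvature f H.toOpenPartialHomeomorph x =
      1 / 2 * (Laplacian.laplacian (fun q => P q 2) : Plane → ℝ) (H x) := by
  have hprojP : ∀ q, proj (P q) = q := fun q => by
    obtain ⟨y, rfl⟩ := H.surjective q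
    rw [← Function.comp_apply (f := P), ← hfP]
    exact (congrFun hH y).symm
  have hPd : Differentiable ℝ P := hP.differentiable (by simp)
  have hHd : ∀ y, MDifferentiableAt (𝓡 2) (𝓡 2) H y := fun y => by
    rw [hH]; exact hf.contMDiff_proj.mdifferentiable (by simp) y
  have hinj : ∀ y, Function.Injective (mfderiv (𝓡 2) (𝓡 2) H y) := fun y => by
    rw [hH]; exact hf.injective_mfderiv_proj y
  have hdf : ∀ y, df f y = (fderiv ℝ P (H y) ∘L (mfderiv (𝓡 2) (𝓡 2) H y :
      TangentSpace (𝓡 2) y →L[ℝ] Plane) : TangentSpace (𝓡 2) y →L[ℝ] Space) := fun y => by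
    have h := mfderiv_comp (I := 𝓡 2) (I' := 𝓡 2) (I'' := 𝓡 3) y (g := P) (f := H)
      (hPd _).mdifferentiableAt (hHd y)
    rw [← hfP, mfderiv_eq_fderiv] at h
    exact h
  have hcoord : ∀ i y, (mfderiv (𝓡 2) (𝓡 2) H y)
      (coordField H.toOpenPartialHomeomorph i y) = EuclideanSpace.single i (1 : ℝ) :=
    fun i y => apply_inverse_of_injective (hinj y) _
  have hdfc : ∀ i y, df f y (coordField H.toOpenPartialHomeomorph i y) =
      fderiv ℝ P (H y) (EuclideanSpace.single i (1 : ℝ)) := fun i y => by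
    rw [hdf, ← hcoord i y]; rfl
  have hpd : ∀ q v, proj (fderiv ℝ P q v) = v := fun q v => by
    have h := (proj.hasFDerivAt.comp q (hPd q).hasFDerivAt).unique
      ((hasFDerivAt_id q).congr_of_eventuallyEq (Eventually.of_forall hprojP))
    exact congrArg (fun L => L v) h
  have hmetric : metricMatrix f H.toOpenPartialHomeomorph x = 1 := by
    ext i j
    have h0 : ∀ v : Plane, fderiv ℝ P (H x) v 0 = v 0 ∧ fderiv ℝ P (H x) v 1 = v 1 := fun v =>
      ⟨congrArg (fun u : Plane => u 0) (hpd (H x) v), congrArg (fun u : Plane => u 1) (hpd (H x) v)⟩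
    simp only [metricMatrix, Matrix.of_apply, inducedMetric, hdfc, form, (h0 _).1, (h0 _).2]
    fin_cases i <;> fin_cases j <;> simp
  have hsecond : ∀ i j, secondFundMatrix f H.toOpenPartialHomeomorph x i j =
      fderiv ℝ (fderiv ℝ (fun q => P q 2)) (H x) (EuclideanSpace.single i 1)
        (EuclideanSpace.single j 1) := by
    intro i j
    have hP2 : Differentiable ℝ (fderiv ℝ P) :=
      (hP.fderiv_right (m := ∞) (by simp)).differentiable (by simp)
    let Q : Plane → Space := fun q => fderiv ℝ P q (EuclideanSpace.single j 1)
    have hQ : Differentiable ℝ Q := fun q => (hP2 q).clm_apply (differentiableAt_const _)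
    have hamb : ambientDeriv f (coordField H.toOpenPartialHomeomorph i)
        (coordField H.toOpenPartialHomeomorph j) x =
        fderiv ℝ Q (H x) (EuclideanSpace.single i 1) := by
      have hfun : (fun y => df f y (coordField H.toOpenPartialHomeomorph j y)) = Q ∘ H :=
        funext fun y => hdfc j y
      have h := mfderiv_comp (I := 𝓡 2) (I' := 𝓡 2) (I'' := 𝓘(ℝ, Space)) x (g := Q) (f := H)
        (hQ _).mdifferentiableAt (hHd x)
      rw [ambientDeriv, hfun, h, mfderiv_eq_fderiv, ← hcoord i x]
      rfl
    let π₂ : Space →L[ℝ] ℝ := EuclideanSpace.proj 2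
    have hψ : fderiv ℝ (fun q => P q 2) = fun q => π₂ ∘L fderiv ℝ P q := funext fun q =>
      (π₂.hasFDerivAt.comp q (hPd q).hasFDerivAt).fderiv
    -- `proj ∘ Q` is constant, so the derivative of `Q` is vertical and equals its own `xi`-part.
    have hvert : fderiv ℝ Q (H x) (EuclideanSpace.single i 1) =
        (fderiv ℝ (fderiv ℝ (fun q => P q 2)) (H x) (EuclideanSpace.single i 1)
        (EuclideanSpace.single j 1)) • xi := by
      have hp0 : proj (fderiv ℝ Q (H x) (EuclideanSpace.single i 1)) = 0 := by
        have h := (proj.hasFDerivAt.comp (H x) (hQ (H x)).hasFDerivAt).unique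
          ((hasFDerivAt_const (EuclideanSpace.single j (1 : ℝ) : Plane) (H x)).congr_of_eventuallyEq
            (Eventually.of_forall fun q => hpd q _))
        exact congrArg (fun L => L (EuclideanSpace.single i 1)) h
      have h2 : fderiv ℝ (fderiv ℝ (fun q => P q 2)) (H x) (EuclideanSpace.single i 1)
          (EuclideanSpace.single j 1) =
          fderiv ℝ Q (H x) (EuclideanSpace.single i 1) 2 := by
        have ha : HasFDerivAt (fun q => fderiv ℝ (fun q => P q 2) q (EuclideanSpace.single j 1))
            (π₂ ∘L fderiv ℝ Q (H x)) (H x) := by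
          rw [hψ]; exact π₂.hasFDerivAt.comp (H x) (hQ (H x)).hasFDerivAt
        have hd : DifferentiableAt ℝ (fderiv ℝ (fun q => P q 2)) (H x) := by
          rw [hψ]; exact (differentiableAt_const _).clm_comp (hP2 _)
        have hb := hd.hasFDerivAt.clm_apply
          (hasFDerivAt_const (EuclideanSpace.single j (1 : ℝ) : Plane) (H x))
        have := congrArg (fun L => L (EuclideanSpace.single i 1)) (hb.unique ha)
        simpa [π₂] using this
      rw [h2]
      have e0 := congrArg (fun u : Plane => u 0) hp0
      have e1 := congrArg (fun u : Plane => u 1) hp0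
      ext k
      fin_cases k
      · simpa [xi] using e0
      · simpa [xi] using e1
      · simp [xi]
    rw [secondFundMatrix, Matrix.of_apply, secondFundForm, hamb, hvert, normalCoeff_smul_xi hf]
  rw [meanCurvature, hmetric, inv_one,
    InnerProductSpace.laplacian_eq_iteratedFDeriv_orthonormalBasis _
      (EuclideanSpace.basisFun (Fin 2) ℝ)]
  simp [hsecond, iteratedFDeriv_two_apply]

end Curvature

end Isotropic

theorem corollary4p1 {M : Type*} [TopologicalSpace M] [T2Space M] [ConnectedSpace M]
    [ChartedSpace Isotropic.Plane M] [IsManifold (𝓡 2) ∞ M]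
    (f : M → Isotropic.Space) (hmin : Isotropic.IsDMinimal f)
    (hcomplete : Isotropic.IsCompleteSurface f) :
    ∃ ψ : Isotropic.Plane → ℝ,
      ContDiff ℝ ∞ ψ ∧ InnerProductSpace.HarmonicOnNhd ψ Set.univ ∧
      Set.range f = {p : Isotropic.Space | ∃ u v : ℝ, p = !₂[u, v, ψ !₂[u, v]]} := by
  have hf := hmin.nondegenerate
  obtain ⟨H, hH, hHm⟩ := hf.exists_global_chart hcomplete
  have hHs : ContMDiff (𝓡 2) (𝓡 2) ∞ H.symm :=
    contMDiffOn_univ.1 (contMDiffOn_symm_of_mem_maximalAtlas hHm)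
  have hP : ContDiff ℝ ∞ (f ∘ H.symm) := (hf.contMDiff.comp hHs).contDiff
  have hψ : ContDiff ℝ ∞ (fun q => (f ∘ H.symm) q 2) :=
    (EuclideanSpace.proj (𝕜 := ℝ) (2 : Fin 3)).contDiff.comp hP
  refine ⟨fun q => (f ∘ H.symm) q 2, hψ, fun q _ => ⟨(contDiff_infty.1 hψ 2).contDiffAt, ?_⟩, ?_⟩
  · refine Filter.Eventually.of_forall fun q => ?_
    have h := Isotropic.meanCurvature_graph hf H hH hP (funext fun y => by simp) (H.symm q)
    rw [hmin.meanCurvature_eq_zero _ hHm _ (Set.mem_univ _), H.apply_symm_apply] at h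
    simpa using h.symm
  · have hgraph : ∀ y, f y = !₂[H y 0, H y 1, f y 2] := fun y => by
      rw [hH]
      ext i
      fin_cases i <;> simp
    ext p
    constructor
    · rintro ⟨y, rfl⟩
      refine ⟨H y 0, H y 1, ?_⟩
      have hy : (!₂[H y 0, H y 1] : Isotropic.Plane) = H y := by
        ext i; fin_cases i <;> simp
      rw [hy]
      simpa using hgraph y
    · rintro ⟨u, v, rfl⟩
      refine ⟨H.symm !₂[u, v], ?_⟩
      rw [hgraph]
      simp
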